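/- For every $\gamma\in(0,1)$ there is a constant $C_\gamma\in(0,\infty)$, depending only on $\gamma$, such that the following holds. Let $(\Omega,\mathcal F,(\mathcal F_t)_{t\ge 0},\mathbb P)$ be any filtered probability space, let $m\in(0,\infty)$, and let $(M_t)_{t\ge 0}$ be a nonnegative continuous local martingale on it with $M_0=m$ almost surely. Let $\langle M\rangle$ denote its bracket, that is, the continuous adapted nondecreasing process with $\langle M\rangle_0=0$ (unique up to indistinguishability) such that $M^2-\langle M\rangle$ is a continuous local martingale, and let $\langle M\rangle_\infty=\lim_{t\to\infty}\langle M\rangle_t\in[0,\infty]$. Then $$\mathbb E\Big[\sup_{t\in[0,\infty)} M_t^\gamma+\langle M\rangle_\infty^{\gamma/2}\Big]\le C_\gamma\, m^\gamma .$$ (Nonnegativity, path continuity and monotonicity are required only almost surely. The filtration need not satisfy the usual conditions; in that generality the inequality is asserted for every process $\langle M\rangle$ with the stated properties.) -/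

import Mathlib

open MeasureTheory ProbabilityTheory
open scoped NNReal ENNReal

/-- A real process `X` indexed by `[0, ∞)` is a continuous local martingale for the filtration `𝓕`:
it is adapted, almost all its paths are continuous, and there are stopping times `τ n` increasing
almost surely to infinity such that every `X^{τ n} 1_{τ n > 0}` is a martingale. -/
structure IsContinuousLocalMartingale {Ω : Type*} {mΩ : MeasurableSpace Ω}
    (X : ℝ≥0 → Ω → ℝ) (𝓕 : Filtration ℝ≥0 mΩ) (P : Measure Ω) : Prop where
  adapted : StronglyAdapted 𝓕 X
  continuous_paths : ∀ᵐ ω ∂P, Continuous fun t => X t ω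
  locally_martingale : Locally (fun Y : ℝ≥0 → Ω → ℝ => Martingale Y 𝓕 P) 𝓕 X P

/-- `A` is (a version of) the bracket `⟨M⟩` of the continuous local martingale `M`: the
adapted, continuous, nondecreasing process started at `0` for which `M² - A` is a continuous
local martingale. Such a process is unique up to indistinguishability. -/
structure IsBracket {Ω : Type*} {mΩ : MeasurableSpace Ω}
    (A M : ℝ≥0 → Ω → ℝ) (𝓕 : Filtration ℝ≥0 mΩ) (P : Measure Ω) : Prop where
  adapted : StronglyAdapted 𝓕 A
  start_zero : ∀ᵐ ω ∂P, A 0 ω = 0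
  continuous_paths : ∀ᵐ ω ∂P, Continuous fun t => A t ω
  monotone_paths : ∀ᵐ ω ∂P, Monotone fun t => A t ω
  sq_sub : IsContinuousLocalMartingale (fun t ω => M t ω ^ 2 - A t ω) 𝓕 P

/-- The terminal value `A_∞ = lim_{t → ∞} A_t = sup_t A_t ∈ [0, ∞]` of a nonnegative
nondecreasing process. -/
noncomputable def terminalValue {Ω : Type*} (A : ℝ≥0 → Ω → ℝ) (ω : Ω) : ℝ≥0∞ :=
  ⨆ t : ℝ≥0, ENNReal.ofReal (A t ω)

open Filter Topology

/-! ### Tail bounds and moments -/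

/-! Write `M*` for the supremum of `M`. Both terms follow from weak-type bounds: if `P(f > x) ≤ K /
x` for all `x > 0`, then for `γ < 1` the layer-cake formula gives `E[f ^ γ] ≤ K ^ γ / (1 - γ)`. For
`f = M*`, Doob's maximal inequality gives `K = m` (`measure_lt_denseSup_le`). For `f = A_∞ ^ (1/2)`,
one has `K = 3 * m` (`measure_lt_terminalValue_le`): stop when `M` exceeds `x ≥ m`, at time `T`. Up
to localization, `E[A_T] ≤ E[M_T²] ≤ E[min(M*, x)²] ≤ 2 * x * m`, the last step again by the maximal
inequality. Markov's inequality then gives `P(A_∞ > x², M* ≤ x) ≤ 2 * m / x`, and `P(M* > x) ≤ m /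
x` covers the rest. Without the usual conditions `T` need not be a stopping time. It is approximated
from above by stopping times with countable range (`crossTime`), and uniform integrability carries
optional sampling to the limit. -/

theorem lintegral_Ioi_mul_rpow_le {K γ : ℝ} (hK : 0 < K) (hγ0 : 0 < γ) (hγ1 : γ < 1)
    {F : ℝ → ℝ≥0∞} (h1 : ∀ t, F t ≤ 1) (h2 : ∀ t, 0 < t → F t ≤ ENNReal.ofReal (K / t)) :
    ENNReal.ofReal γ * ∫⁻ t in Set.Ioi 0, F t * ENNReal.ofReal (t ^ (γ - 1))
      ≤ ENNReal.ofReal (K ^ γ / (1 - γ)) := by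
  -- The bounds `1` and `K / t` cross at `t = K`; beyond it, `γ < 1` makes `t ^ (γ - 2)` integrable.
  have hsplit : Set.Ioi (0 : ℝ) = Set.Ioc 0 K ∪ Set.Ioi K := (Set.Ioc_union_Ioi_eq_Ioi hK.le).symm
  have hnear : ∫⁻ t in Set.Ioc 0 K, F t * ENNReal.ofReal (t ^ (γ - 1))
      ≤ ENNReal.ofReal (K ^ γ / γ) := by
    have hint : IntervalIntegrable (fun t : ℝ => t ^ (γ - 1)) volume 0 K :=
      intervalIntegral.intervalIntegrable_rpow' (by linarith)
    calc ∫⁻ t in Set.Ioc 0 K, F t * ENNReal.ofReal (t ^ (γ - 1))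
        ≤ ∫⁻ t in Set.Ioc 0 K, ENNReal.ofReal (t ^ (γ - 1)) :=
          lintegral_mono fun t => mul_le_of_le_one_left' (h1 t)
      _ = ENNReal.ofReal (∫ t in Set.Ioc 0 K, t ^ (γ - 1)) := by
          rw [ofReal_integral_eq_lintegral_ofReal ((intervalIntegrable_iff_integrableOn_Ioc_of_le
            hK.le).1 hint)]
          filter_upwards [ae_restrict_mem measurableSet_Ioc] with t ht
          exact Real.rpow_nonneg ht.1.le _
      _ = ENNReal.ofReal (K ^ γ / γ) := by
          rw [← intervalIntegral.integral_of_le hK.le, integral_rpow (Or.inl (by linarith))]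
          simp [Real.zero_rpow hγ0.ne']
  have hfar : ∫⁻ t in Set.Ioi K, F t * ENNReal.ofReal (t ^ (γ - 1))
      ≤ ENNReal.ofReal (K ^ γ / (1 - γ)) := by
    calc ∫⁻ t in Set.Ioi K, F t * ENNReal.ofReal (t ^ (γ - 1))
        ≤ ∫⁻ t in Set.Ioi K, ENNReal.ofReal (K * t ^ (γ - 2)) := by
          refine setLIntegral_mono' measurableSet_Ioi fun t ht => ?_
          have ht0 : 0 < t := hK.trans ht
          calc F t * ENNReal.ofReal (t ^ (γ - 1))
              ≤ ENNReal.ofReal (K / t) * ENNReal.ofReal (t ^ (γ - 1)) := by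
                gcongr; exact h2 t ht0
            _ = ENNReal.ofReal (K * t ^ (γ - 2)) := by
                rw [← ENNReal.ofReal_mul (by positivity)]
                congr 1
                rw [show γ - 1 = (γ - 2) + 1 by ring, Real.rpow_add_one ht0.ne']
                field_simp
      _ = ENNReal.ofReal (∫ t in Set.Ioi K, K * t ^ (γ - 2)) := by
          rw [ofReal_integral_eq_lintegral_ofReal
            ((integrableOn_Ioi_rpow_of_lt (by linarith) hK).const_mul K)]
          filter_upwards [ae_restrict_mem measurableSet_Ioi] with t ht
          have ht0 : 0 < t := hK.trans ht
          positivity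
      _ = ENNReal.ofReal (K ^ γ / (1 - γ)) := by
          rw [integral_const_mul, integral_Ioi_rpow_of_lt (by linarith) hK]
          congr 1
          rw [show γ - 2 + 1 = γ - 1 by ring, Real.rpow_sub_one hK.ne']
          have : γ - 1 ≠ 0 := by linarith
          have : 1 - γ ≠ 0 := by linarith
          field_simp
          ring
  rw [hsplit]
  calc _ ≤ ENNReal.ofReal γ * (ENNReal.ofReal (K ^ γ / γ) + ENNReal.ofReal (K ^ γ / (1 - γ))) := by
        gcongr
        exact (lintegral_union_le _ _ _).trans (add_le_add hnear hfar)
    _ = ENNReal.ofReal (K ^ γ / (1 - γ)) := by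
        have : 0 < 1 - γ := by linarith
        rw [← ENNReal.ofReal_add (by positivity) (by positivity),
          ← ENNReal.ofReal_mul hγ0.le]
        congr 1
        field_simp
        ring

section Tail

variable {Ω : Type*} {mΩ : MeasurableSpace Ω} {P : Measure Ω}

theorem ofReal_lt_of_lt_toReal {t : ℝ} (ht : 0 ≤ t) {x : ℝ≥0∞} (h : t < x.toReal) :
    ENNReal.ofReal t < x :=
  ((ENNReal.ofReal_lt_ofReal_iff (ht.trans_lt h)).2 h).trans_le ENNReal.ofReal_toReal_le

theorem ae_lt_top_of_tail_le {f : Ω → ℝ≥0∞} {K : ℝ}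
    (h : ∀ x : ℝ, 0 < x → P {ω | ENNReal.ofReal x < f ω} ≤ ENNReal.ofReal (K / x)) :
    ∀ᵐ ω ∂P, f ω < ∞ := by
  have hlim : Tendsto (fun x : ℝ => ENNReal.ofReal (K / x)) atTop (𝓝 0) := by
    have := ENNReal.tendsto_ofReal (tendsto_const_nhds (x := K).div_atTop tendsto_id)
    simpa using this
  rw [ae_iff]
  refine le_antisymm (ge_of_tendsto hlim ?_) zero_le
  filter_upwards [eventually_gt_atTop 0] with x hx
  refine (measure_mono fun ω hω => ?_).trans (h x hx)
  have : f ω = ∞ := by simpa using hω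
  simp [this]

theorem lintegral_rpow_le_of_tail_le [IsProbabilityMeasure P] {f : Ω → ℝ≥0∞} (hf : AEMeasurable f P)
    {K γ : ℝ} (hK : 0 < K) (hγ0 : 0 < γ) (hγ1 : γ < 1)
    (h : ∀ x : ℝ, 0 < x → P {ω | ENNReal.ofReal x < f ω} ≤ ENNReal.ofReal (K / x)) :
    ∫⁻ ω, f ω ^ γ ∂P ≤ ENNReal.ofReal (K ^ γ / (1 - γ)) := by
  have hfin := ae_lt_top_of_tail_le h
  calc ∫⁻ ω, f ω ^ γ ∂P = ∫⁻ ω, ENNReal.ofReal ((f ω).toReal ^ γ) ∂P := by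
        refine lintegral_congr_ae ?_
        filter_upwards [hfin] with ω hω
        rw [ENNReal.toReal_rpow, ENNReal.ofReal_toReal (by finiteness)]
    _ = _ := lintegral_rpow_eq_lintegral_meas_lt_mul P (ae_of_all _ fun _ => ENNReal.toReal_nonneg)
        hf.ennreal_toReal hγ0
    _ ≤ _ := by
        refine lintegral_Ioi_mul_rpow_le hK hγ0 hγ1 (fun t => prob_le_one) fun t ht => ?_
        refine (measure_mono fun ω hω => ?_).trans (h t ht)
        exact ofReal_lt_of_lt_toReal ht.le hω

/-- By layer cake the integral is at most `∫₀ᵃ 2 t (K / t) dt`. The growth is linear in `a`, where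
the trivial bound is `a ^ 2`; this gain is what makes the bracket estimate work. -/
theorem integral_min_toReal_sq_le [IsProbabilityMeasure P] {f : Ω → ℝ≥0∞} (hf : Measurable f)
    {K a : ℝ} (hK : 0 ≤ K) (ha : 0 < a)
    (h : ∀ x : ℝ, 0 < x → P {ω | ENNReal.ofReal x < f ω} ≤ ENNReal.ofReal (K / x)) :
    Integrable (fun ω => (min (f ω) (ENNReal.ofReal a)).toReal ^ 2) P ∧
      ∫ ω, (min (f ω) (ENNReal.ofReal a)).toReal ^ 2 ∂P ≤ 2 * a * K := by
  set g : Ω → ℝ := fun ω => (min (f ω) (ENNReal.ofReal a)).toReal with hg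
  have hgm : Measurable g := (hf.min measurable_const).ennreal_toReal
  have hga : ∀ ω, g ω ≤ a := fun ω =>
    ENNReal.toReal_le_of_le_ofReal ha.le (min_le_right _ _)
  have hg0 : ∀ ω, 0 ≤ g ω := fun ω => ENNReal.toReal_nonneg
  have key : ∫⁻ ω, ENNReal.ofReal (g ω ^ (2 : ℝ)) ∂P ≤ ENNReal.ofReal (2 * a * K) := by
    rw [lintegral_rpow_eq_lintegral_meas_lt_mul P (ae_of_all _ hg0) hgm.aemeasurable two_pos]
    have hle : ∫⁻ t in Set.Ioi 0, P {ω | t < g ω} * ENNReal.ofReal (t ^ ((2 : ℝ) - 1))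
        ≤ ∫⁻ t in Set.Ioi 0, (Set.Ioc 0 a).indicator (fun _ => ENNReal.ofReal K) t := by
      refine setLIntegral_mono' measurableSet_Ioi fun t (ht : 0 < t) => ?_
      by_cases hta : t ≤ a
      · rw [Set.indicator_of_mem (Set.mem_Ioc.2 ⟨ht, hta⟩)]
        calc P {ω | t < g ω} * ENNReal.ofReal (t ^ ((2 : ℝ) - 1))
            ≤ ENNReal.ofReal (K / t) * ENNReal.ofReal (t ^ ((2 : ℝ) - 1)) := by
              gcongr
              refine (measure_mono fun ω hω => ?_).trans (h t ht)
              exact lt_of_lt_of_le (ofReal_lt_of_lt_toReal ht.le hω) (min_le_left _ _)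
          _ = ENNReal.ofReal K := by
              rw [← ENNReal.ofReal_mul (by positivity)]
              congr 1
              norm_num
              field_simp
      · have : {ω | t < g ω} = ∅ := by
          ext ω
          simpa using (hga ω).trans (not_le.1 hta).le
        simp [this]
    calc _ ≤ ENNReal.ofReal 2 * ∫⁻ t, (Set.Ioc 0 a).indicator (fun _ => ENNReal.ofReal K) t := by
          gcongr ENNReal.ofReal 2 * ?_
          exact hle.trans (setLIntegral_le_lintegral _ _)
      _ = ENNReal.ofReal (2 * a * K) := by
          rw [lintegral_indicator_const measurableSet_Ioc, Real.volume_Ioc, sub_zero,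
            ← ENNReal.ofReal_mul hK, ← ENNReal.ofReal_mul two_pos.le]
          congr 1
          ring
  have hint : Integrable (fun ω => g ω ^ 2) P :=
    Integrable.of_bound (hgm.pow_const 2).aestronglyMeasurable (a ^ 2) <| ae_of_all _ fun ω => by
      rw [Real.norm_of_nonneg (by positivity)]
      exact pow_le_pow_left₀ (hg0 ω) (hga ω) 2
  refine ⟨hint, ?_⟩
  rw [← ENNReal.ofReal_le_ofReal_iff (by positivity),
    ofReal_integral_eq_lintegral_ofReal hint (ae_of_all _ fun ω => by positivity)]
  simpa using key

/-- A Fatou lemma for events; it removes the localization from the tail bounds. -/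
theorem measure_eventually_mem_le {s : ℕ → Set Ω} {c : ℝ≥0∞} (h : ∀ k, P (s k) ≤ c) :
    P {ω | ∀ᶠ k in atTop, ω ∈ s k} ≤ c := by
  have heq : {ω | ∀ᶠ k in atTop, ω ∈ s k} = ⋃ n : ℕ, ⋂ k ≥ n, s k := by
    ext ω
    simp [eventually_atTop]
  have hmono : Monotone fun n : ℕ => ⋂ k ≥ n, s k := fun i j hij =>
    Set.biInter_subset_biInter_left fun k hk => le_trans hij hk
  rw [heq, hmono.measure_iUnion]
  exact iSup_le fun n => (measure_mono (Set.biInter_subset_of_mem (le_refl n))).trans (h n)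

end Tail

/-! ### Optional sampling along a dense sequence of times -/

section CrossTime

variable {Ω : Type*} {mΩ : MeasurableSpace Ω} {P : Measure Ω} {𝓕 : Filtration ℝ≥0 mΩ}
  {X Y : ℝ≥0 → Ω → ℝ} {a : ℝ} {t : ℝ≥0}

/-- The minimum of `t` and of those among the first `N` times of a dense sequence at which the
process `X` exceeds the level `a`. -/
noncomputable def crossTime (X : ℝ≥0 → Ω → ℝ) (a : ℝ) (t : ℝ≥0) : ℕ → Ω → ℝ≥0
  | 0 => fun _ => t
  | N + 1 => fun ω =>
      haveI := Classical.propDecidable (a < X (TopologicalSpace.denseSeq ℝ≥0 N) ω)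
      if a < X (TopologicalSpace.denseSeq ℝ≥0 N) ω then
        min (crossTime X a t N ω) (TopologicalSpace.denseSeq ℝ≥0 N)
      else crossTime X a t N ω

theorem crossTime_succ_of_lt {N : ℕ} {ω : Ω} (h : a < X (TopologicalSpace.denseSeq ℝ≥0 N) ω) :
    crossTime X a t (N + 1) ω = min (crossTime X a t N ω) (TopologicalSpace.denseSeq ℝ≥0 N) := by
  simp [crossTime, h]

theorem crossTime_succ_of_not_lt {N : ℕ} {ω : Ω}
    (h : ¬ a < X (TopologicalSpace.denseSeq ℝ≥0 N) ω) :
    crossTime X a t (N + 1) ω = crossTime X a t N ω := by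
  simp [crossTime, h]

theorem antitone_crossTime (ω : Ω) : Antitone fun N => crossTime X a t N ω := by
  refine antitone_nat_of_succ_le fun N => ?_
  by_cases h : a < X (TopologicalSpace.denseSeq ℝ≥0 N) ω
  · rw [crossTime_succ_of_lt h]; exact min_le_left _ _
  · rw [crossTime_succ_of_not_lt h]

theorem crossTime_le (N : ℕ) (ω : Ω) : crossTime X a t N ω ≤ t :=
  antitone_crossTime ω (Nat.zero_le N)

theorem crossTime_le_of_lt {N i : ℕ} (hi : i < N) {ω : Ω}
    (h : a < X (TopologicalSpace.denseSeq ℝ≥0 i) ω) :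
    crossTime X a t N ω ≤ TopologicalSpace.denseSeq ℝ≥0 i := by
  refine (antitone_crossTime ω (Nat.succ_le_of_lt hi)).trans ?_
  exact (crossTime_succ_of_lt h).trans_le (min_le_right _ _)

theorem crossTime_eq_of_forall_le {ω : Ω}
    (h : ∀ i, X (TopologicalSpace.denseSeq ℝ≥0 i) ω ≤ a) (N : ℕ) : crossTime X a t N ω = t := by
  induction N with
  | zero => rfl
  | succ N ih => rw [crossTime_succ_of_not_lt (h N).not_gt, ih]

theorem crossTime_eq_or_lt (N : ℕ) (ω : Ω) :
    crossTime X a t N ω = t ∨ a < X (crossTime X a t N ω) ω := by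
  induction N with
  | zero => exact Or.inl rfl
  | succ N ih =>
    by_cases h : a < X (TopologicalSpace.denseSeq ℝ≥0 N) ω
    · rw [crossTime_succ_of_lt h]
      rcases min_choice (crossTime X a t N ω) (TopologicalSpace.denseSeq ℝ≥0 N) with h' | h' <;>
        rw [h']
      · exact ih
      · exact Or.inr h
    · rwa [crossTime_succ_of_not_lt h]

/-- Among finitely many times bounded by `t`, one at which `X` exceeds `a` forces the crossing
time to be such a time. -/
theorem lt_apply_crossTime {N i : ℕ} (hi : i < N) {ω : Ω}
    (h : a < X (TopologicalSpace.denseSeq ℝ≥0 i) ω) (hit : TopologicalSpace.denseSeq ℝ≥0 i ≤ t) :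
    a < X (crossTime X a t N ω) ω := by
  induction N with
  | zero => simp at hi
  | succ N ih =>
    rcases Nat.lt_succ_iff_lt_or_eq.1 hi with hlt | rfl
    · by_cases hN : a < X (TopologicalSpace.denseSeq ℝ≥0 N) ω
      · rw [crossTime_succ_of_lt hN]
        rcases min_choice (crossTime X a t N ω) (TopologicalSpace.denseSeq ℝ≥0 N) with h' | h' <;>
          rw [h']
        exacts [ih hlt, hN]
      · rw [crossTime_succ_of_not_lt hN]
        exact ih hlt
    · rw [crossTime_succ_of_lt h]
      rcases crossTime_eq_or_lt (X := X) (a := a) (t := t) i ω with h' | h'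
      · rwa [h', min_eq_right hit]
      · rcases min_choice (crossTime X a t i ω) (TopologicalSpace.denseSeq ℝ≥0 i) with h'' | h'' <;>
          rw [h'']
        exacts [h', h]

theorem isStoppingTime_crossTime (hX : StronglyAdapted 𝓕 X) (N : ℕ) :
    IsStoppingTime 𝓕 fun ω => (crossTime X a t N ω : WithTop ℝ≥0) := by
  induction N with
  | zero => exact isStoppingTime_const 𝓕 t
  | succ N ih =>
    intro i
    have hset : {ω | (crossTime X a t (N + 1) ω : WithTop ℝ≥0) ≤ i}
        = {ω | (crossTime X a t N ω : WithTop ℝ≥0) ≤ i} ∪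
          {ω | TopologicalSpace.denseSeq ℝ≥0 N ≤ i ∧
            a < X (TopologicalSpace.denseSeq ℝ≥0 N) ω} := by
      ext ω
      by_cases h : a < X (TopologicalSpace.denseSeq ℝ≥0 N) ω
      · simp only [Set.mem_ofPred_eq, Set.mem_union, WithTop.coe_le_coe, crossTime_succ_of_lt h,
          min_le_iff, h, and_true]
      · simp [crossTime_succ_of_not_lt h, h]
    rw [hset]
    refine (ih i).union ?_
    by_cases hi : TopologicalSpace.denseSeq ℝ≥0 N ≤ i
    · simp only [hi, true_and]
      exact 𝓕.mono hi _ ((hX _).measurable measurableSet_Ioi)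
    · simp [hi]

theorem countable_range_crossTime (N : ℕ) :
    (Set.range fun ω => (crossTime X a t N ω : WithTop ℝ≥0)).Countable := by
  refine Set.Countable.mono (s₂ := (↑) '' (insert t (Set.range (TopologicalSpace.denseSeq ℝ≥0))))
    ?_ (((Set.countable_range _).insert t).image _)
  rintro _ ⟨ω, rfl⟩
  refine ⟨_, ?_, rfl⟩
  induction N with
  | zero => exact Or.inl rfl
  | succ N ih =>
    by_cases h : a < X (TopologicalSpace.denseSeq ℝ≥0 N) ω
    · rw [crossTime_succ_of_lt h]
      rcases min_choice (crossTime X a t N ω) (TopologicalSpace.denseSeq ℝ≥0 N) with h' | h' <;>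
        rw [h']
      exacts [ih, Or.inr ⟨N, rfl⟩]
    · rwa [crossTime_succ_of_not_lt h]

variable [IsProbabilityMeasure P]

theorem MeasureTheory.Martingale.crossTime_ae_eq_condExp (hY : Martingale Y 𝓕 P) (hX : StronglyAdapted 𝓕 X)
    (a : ℝ) (t : ℝ≥0) (N : ℕ) :
    (fun ω => Y (crossTime X a t N ω) ω)
      =ᵐ[P] P[Y t | (isStoppingTime_crossTime (a := a) (t := t) hX N).measurableSpace] :=
  hY.stoppedValue_ae_eq_condExp_of_le_const_of_countable_range
    (isStoppingTime_crossTime hX N) (fun ω => WithTop.coe_le_coe.2 (crossTime_le N ω))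
    (countable_range_crossTime N)

theorem MeasureTheory.Martingale.integrable_crossTime (hY : Martingale Y 𝓕 P) (hX : StronglyAdapted 𝓕 X)
    (a : ℝ) (t : ℝ≥0) (N : ℕ) : Integrable (fun ω => Y (crossTime X a t N ω) ω) P :=
  integrable_condExp.congr (hY.crossTime_ae_eq_condExp hX a t N).symm

theorem MeasureTheory.Martingale.integral_eq_zero_time (hY : Martingale Y 𝓕 P) (t : ℝ≥0) :
    ∫ ω, Y t ω ∂P = ∫ ω, Y 0 ω ∂P := by
  simpa using (hY.setIntegral_eq (zero_le (a := t)) MeasurableSet.univ).symm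

theorem MeasureTheory.Martingale.integral_crossTime (hY : Martingale Y 𝓕 P) (hX : StronglyAdapted 𝓕 X)
    (a : ℝ) (t : ℝ≥0) (N : ℕ) : ∫ ω, Y (crossTime X a t N ω) ω ∂P = ∫ ω, Y 0 ω ∂P := by
  rw [integral_congr_ae (hY.crossTime_ae_eq_condExp hX a t N),
    integral_condExp (isStoppingTime_crossTime hX N).measurableSpace_le, hY.integral_eq_zero_time]

/-- The sampled variables are conditional expectations of the single integrable variable `Y t`,
hence uniformly integrable, and Vitali's theorem applies. -/
theorem MeasureTheory.Martingale.integral_of_tendsto_crossTime (hY : Martingale Y 𝓕 P)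
    (hX : StronglyAdapted 𝓕 X) (a : ℝ) (t : ℝ≥0) {W : Ω → ℝ}
    (hW : ∀ᵐ ω ∂P, Tendsto (fun N => Y (crossTime X a t N ω) ω) atTop (𝓝 (W ω))) :
    Integrable W P ∧ ∫ ω, W ω ∂P = ∫ ω, Y 0 ω ∂P := by
  have hUI : UniformIntegrable (fun N ω => Y (crossTime X a t N ω) ω) 1 P := by
    have := (hY.integrable t).uniformIntegrable_condExp
      (ℱ := fun N => (isStoppingTime_crossTime (a := a) (t := t) hX N).measurableSpace)
      (fun N => (isStoppingTime_crossTime hX N).measurableSpace_le)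
    exact this.ae_eq fun N => (hY.crossTime_ae_eq_condExp hX a t N).symm
  have hWint := hUI.integrable_of_ae_tendsto hW
  refine ⟨hWint, ?_⟩
  have hL1 := tendsto_Lp_finite_of_tendsto_ae le_rfl ENNReal.one_ne_top hUI.1
    (memLp_one_iff_integrable.2 hWint) hUI.2.1 hW
  have hlim := tendsto_integral_of_L1' W hWint.1
    (Eventually.of_forall fun N => hY.integrable_crossTime hX a t N) hL1
  simp only [hY.integral_crossTime hX] at hlim
  exact tendsto_nhds_unique hlim tendsto_const_nhds |>.symm ▸ rfl

/-- **Maximal inequality** along the first `N` times of a dense sequence. -/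
theorem MeasureTheory.Martingale.measure_exists_lt_le (hY : Martingale Y 𝓕 P)
    (hpos : ∀ᵐ ω ∂P, ∀ t, 0 ≤ Y t ω) {x : ℝ} (hx : 0 < x) (N : ℕ) :
    P {ω | ∃ i < N, x < Y (TopologicalSpace.denseSeq ℝ≥0 i) ω}
      ≤ ENNReal.ofReal ((∫ ω, Y 0 ω ∂P) / x) := by
  -- With this horizon none of the `N` times is cut off, so any exceedance is seen at the crossing
  -- time.
  set t : ℝ≥0 := (Finset.range N).sup (TopologicalSpace.denseSeq ℝ≥0)
  set V : Ω → ℝ := fun ω => Y (crossTime Y x t N ω) ω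
  have hV : Integrable V P := hY.integrable_crossTime hY.stronglyAdapted x t N
  have hsub : {ω | ∃ i < N, x < Y (TopologicalSpace.denseSeq ℝ≥0 i) ω} ⊆ {ω | x ≤ V ω} := by
    rintro ω ⟨i, hi, h⟩
    exact (lt_apply_crossTime hi h (Finset.le_sup (Finset.mem_range.2 hi))).le
  have hm := mul_meas_ge_le_integral_of_nonneg (μ := P) (f := V)
    (hpos.mono fun ω h => h _) hV x
  rw [hY.integral_crossTime hY.stronglyAdapted] at hm
  calc _ ≤ P {ω | x ≤ V ω} := measure_mono hsub
    _ = ENNReal.ofReal (P.real {ω | x ≤ V ω}) := (ofReal_measureReal).symm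
    _ ≤ _ := ENNReal.ofReal_le_ofReal ((le_div_iff₀' hx).2 hm)

end CrossTime

/-! ### Paths up to the limiting crossing time -/

section CrossLimit

variable {Ω : Type*} {X : ℝ≥0 → Ω → ℝ} {a : ℝ} {t : ℝ≥0}

theorem tendsto_crossTime (ω : Ω) :
    Tendsto (fun N => crossTime X a t N ω) atTop (𝓝 (⨅ N, crossTime X a t N ω)) :=
  tendsto_atTop_ciInf (antitone_crossTime ω) (OrderBot.bddBelow _)

/-- Up to and including the limit of the crossing times, a continuous path is below the level. -/
theorem apply_le_of_le_iInf_crossTime {ω : Ω} (hc : Continuous fun s => X s ω) (h0 : X 0 ω ≤ a)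
    {s : ℝ≥0} (hs : s ≤ ⨅ N, crossTime X a t N ω) : X s ω ≤ a := by
  set T := ⨅ N, crossTime X a t N ω
  have hclosed : IsClosed {s | X s ω ≤ a} := isClosed_le hc continuous_const
  have hlt : Set.Iio T ⊆ {s | X s ω ≤ a} := by
    intro s hs
    by_contra hsa
    have hopen : IsOpen (Set.Iio T ∩ {s | a < X s ω}) :=
      isOpen_Iio.inter (isOpen_lt continuous_const hc)
    obtain ⟨i, hi⟩ := (TopologicalSpace.denseRange_denseSeq ℝ≥0).exists_mem_open hopen
      ⟨s, hs, show a < X s ω from not_le.1 hsa⟩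
    have hT : T ≤ TopologicalSpace.denseSeq ℝ≥0 i :=
      (ciInf_le (OrderBot.bddBelow _) (i + 1)).trans (crossTime_le_of_lt (Nat.lt_succ_self i) hi.2)
    exact hT.not_gt hi.1
  -- If the limit time is `0`, the open interval below it is empty and only the initial value helps.
  rcases eq_or_ne s 0 with rfl | hs0
  · exact h0
  · have hne : (Set.Iio T).Nonempty := ⟨0, (pos_iff_ne_zero.2 hs0).trans_le hs⟩
    have := hclosed.closure_subset_iff.2 hlt
    rw [closure_Iio' hne] at this
    exact this hs

end CrossLimit

/-! ### Stopping a path -/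

/-- The minimum of the finite time `s` and the possibly infinite time `σ`. -/
noncomputable def minTime (σ : WithTop ℝ≥0) (s : ℝ≥0) : ℝ≥0 := (min (s : WithTop ℝ≥0) σ).untopA

theorem untopA_coe_nnreal (s : ℝ≥0) : (s : WithTop ℝ≥0).untopA = s := rfl

theorem minTime_top (s : ℝ≥0) : minTime ⊤ s = s := by
  rw [minTime, min_eq_left le_top, untopA_coe_nnreal]

theorem minTime_coe (r s : ℝ≥0) : minTime r s = min s r := by
  rw [minTime, ← WithTop.coe_min, untopA_coe_nnreal]

theorem minTime_le (σ : WithTop ℝ≥0) (s : ℝ≥0) : minTime σ s ≤ s := by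
  induction σ using WithTop.recTopCoe with
  | top => rw [minTime_top]
  | coe r => rw [minTime_coe]; exact min_le_left _ _

theorem minTime_zero (σ : WithTop ℝ≥0) : minTime σ 0 = 0 := le_antisymm (minTime_le σ 0) zero_le

theorem minTime_eq {σ : WithTop ℝ≥0} {s : ℝ≥0} (h : (s : WithTop ℝ≥0) ≤ σ) : minTime σ s = s := by
  rw [minTime, min_eq_left h, untopA_coe_nnreal]

theorem le_minTime {σ : WithTop ℝ≥0} {r s : ℝ≥0} (hrs : r ≤ s) (h : (r : WithTop ℝ≥0) ≤ σ) :
    r ≤ minTime σ s := by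
  induction σ using WithTop.recTopCoe with
  | top => rwa [minTime_top]
  | coe u => rw [minTime_coe]; exact le_min hrs (WithTop.coe_le_coe.1 h)

theorem continuous_minTime (σ : WithTop ℝ≥0) : Continuous (minTime σ) := by
  induction σ using WithTop.recTopCoe with
  | top => exact continuous_id.congr fun s => (minTime_top s).symm
  | coe r =>
    simp only [funext (minTime_coe r)]
    fun_prop

section Stopped

variable {Ω : Type*} {X : ℝ≥0 → Ω → ℝ} {σ : Ω → WithTop ℝ≥0} {ω : Ω}

theorem stoppedProcess_indicator_of_pos (h : ⊥ < σ ω) (s : ℝ≥0) :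
    stoppedProcess (fun i => {ω | ⊥ < σ ω}.indicator (X i)) σ s ω = X (minTime (σ ω) s) ω :=
  Set.indicator_of_mem (s := {ω | ⊥ < σ ω}) h _

theorem stoppedProcess_indicator_of_not_pos (h : ¬ ⊥ < σ ω) (s : ℝ≥0) :
    stoppedProcess (fun i => {ω | ⊥ < σ ω}.indicator (X i)) σ s ω = 0 :=
  Set.indicator_of_notMem (s := {ω | ⊥ < σ ω}) h _

theorem eventually_coe_lt_of_tendsto {τ : ℕ → WithTop ℝ≥0} (h : Tendsto τ atTop (𝓝 ⊤)) (s : ℝ≥0) :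
    ∀ᶠ k in atTop, (s : WithTop ℝ≥0) < τ k :=
  h.eventually (lt_mem_nhds (WithTop.coe_lt_top s))

end Stopped

/-! ### The maximal function -/

section Maximal

variable {Ω : Type*} {mΩ : MeasurableSpace Ω} {P : Measure Ω} {𝓕 : Filtration ℝ≥0 mΩ}
  {M A : ℝ≥0 → Ω → ℝ} {m : ℝ}

/-- The supremum of a process over a countable dense set of times. -/
noncomputable def denseSup (M : ℝ≥0 → Ω → ℝ) (ω : Ω) : ℝ≥0∞ :=
  ⨆ i : ℕ, ENNReal.ofReal (M (TopologicalSpace.denseSeq ℝ≥0 i) ω)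

theorem measurable_denseSup (hM : StronglyAdapted 𝓕 M) : Measurable (denseSup M) :=
  Measurable.iSup fun _ => ((hM _).measurable.mono (𝓕.le _) le_rfl).ennreal_ofReal

theorem le_denseSup {ω : Ω} (hc : Continuous fun s => M s ω) (s : ℝ≥0) :
    ENNReal.ofReal (M s ω) ≤ denseSup M ω := by
  have hclosed : IsClosed {s | ENNReal.ofReal (M s ω) ≤ denseSup M ω} :=
    isClosed_le (ENNReal.continuous_ofReal.comp hc) continuous_const
  have hsub : Set.range (TopologicalSpace.denseSeq ℝ≥0)
      ⊆ {s | ENNReal.ofReal (M s ω) ≤ denseSup M ω} := by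
    rintro _ ⟨i, rfl⟩
    exact le_iSup (fun i => ENNReal.ofReal (M (TopologicalSpace.denseSeq ℝ≥0 i) ω)) i
  have := hclosed.closure_subset_iff.2 hsub
  rw [(TopologicalSpace.denseRange_denseSeq ℝ≥0).closure_range] at this
  exact this (Set.mem_univ s)

theorem IsBracket.ae_nonneg (hA : IsBracket A M 𝓕 P) : ∀ᵐ ω ∂P, ∀ t, 0 ≤ A t ω := by
  filter_upwards [hA.start_zero, hA.monotone_paths] with ω h0 hmono t
  exact h0.symm.trans_le (hmono zero_le)

theorem IsBracket.aemeasurable_terminalValue (hA : IsBracket A M 𝓕 P) :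
    AEMeasurable (terminalValue A) P := by
  have hmeas : Measurable fun ω => ⨆ k : ℕ, ENNReal.ofReal (A k ω) :=
    Measurable.iSup fun k => ((hA.adapted _).measurable.mono (𝓕.le _) le_rfl).ennreal_ofReal
  refine ⟨_, hmeas, ?_⟩
  filter_upwards [hA.monotone_paths] with ω hmono
  refine le_antisymm (iSup_le fun t => ?_) (iSup_le fun k => ?_)
  · obtain ⟨k, hk⟩ := exists_nat_ge t
    exact (ENNReal.ofReal_le_ofReal (hmono hk)).trans
      (le_iSup (fun k : ℕ => ENNReal.ofReal (A k ω)) k)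
  · exact le_iSup (fun t : ℝ≥0 => ENNReal.ofReal (A t ω)) k

variable [IsProbabilityMeasure P]

/-- **Maximal inequality** for nonnegative continuous local martingales. -/
theorem IsContinuousLocalMartingale.measure_lt_denseSup_le
    (hM : IsContinuousLocalMartingale M 𝓕 P) (hpos : ∀ᵐ ω ∂P, ∀ t, 0 ≤ M t ω)
    (hm : 0 ≤ m) (h0 : ∀ᵐ ω ∂P, M 0 ω = m) {x : ℝ} (hx : 0 < x) :
    P {ω | ENNReal.ofReal x < denseSup M ω} ≤ ENNReal.ofReal (m / x) := by
  obtain ⟨τ, hτ, hmart⟩ := hM.locally_martingale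
  set Y : ℕ → ℝ≥0 → Ω → ℝ := fun k =>
    stoppedProcess (fun i => {ω | ⊥ < τ k ω}.indicator (M i)) (τ k) with hY
  have hYpos : ∀ k, ∀ᵐ ω ∂P, ∀ t, 0 ≤ Y k t ω := fun k => by
    filter_upwards [hpos] with ω hω t
    by_cases h : ⊥ < τ k ω
    · exact (hω _).trans_eq (stoppedProcess_indicator_of_pos h t).symm
    · exact (stoppedProcess_indicator_of_not_pos h t).ge
  -- Only an inequality: the localized process vanishes where `τ k = 0`.
  have hY0 : ∀ k, ∫ ω, Y k 0 ω ∂P ≤ m := fun k => by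
    have hle : ∀ᵐ ω ∂P, Y k 0 ω ≤ m := by
      filter_upwards [h0] with ω hω
      by_cases h : ⊥ < τ k ω
      · refine (stoppedProcess_indicator_of_pos h 0).trans_le ?_
        rw [minTime_zero, hω]
      · exact (stoppedProcess_indicator_of_not_pos h 0).trans_le hm
    exact (integral_mono_ae ((hmart k).integrable 0) (integrable_const m) hle).trans_eq (by simp)
  have hbound := measure_eventually_mem_le (P := P) (c := ENNReal.ofReal (m / x))
    -- The index `k` counts both the sampled times and the localization, so one limit handles both.
    (s := fun k => {ω | ∃ i < k, x < Y k (TopologicalSpace.denseSeq ℝ≥0 i) ω}) fun k =>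
      ((hmart k).measure_exists_lt_le (hYpos k) hx k).trans
        (ENNReal.ofReal_le_ofReal (div_le_div_of_nonneg_right (hY0 k) hx.le))
  refine (measure_mono_ae ?_).trans hbound
  filter_upwards [hτ.tendsto_top] with ω hω (hlt : ENNReal.ofReal x < denseSup M ω)
  obtain ⟨i, hi⟩ := lt_iSup_iff.1 hlt
  have hi' := (ENNReal.ofReal_lt_ofReal_iff_of_nonneg hx.le).1 hi
  change ∀ᶠ k in atTop, ∃ i < k, x < Y k (TopologicalSpace.denseSeq ℝ≥0 i) ω
  filter_upwards [eventually_gt_atTop i,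
    eventually_coe_lt_of_tendsto hω (TopologicalSpace.denseSeq ℝ≥0 i)] with k hk hτk
  refine ⟨i, hk, hi'.trans_eq ?_⟩
  rw [hY]
  exact (congrArg (M · ω) (minTime_eq hτk.le)).symm.trans
    (stoppedProcess_indicator_of_pos (bot_le.trans_lt hτk) _).symm

/-- Where `M` stays below the level `x`, the stopped bracket is large with small probability. -/
theorem IsBracket.measure_stopped_le (hA : IsBracket A M 𝓕 P)
    (hM : IsContinuousLocalMartingale M 𝓕 P) (hpos : ∀ᵐ ω ∂P, ∀ t, 0 ≤ M t ω)
    (hm : 0 < m) (h0 : ∀ᵐ ω ∂P, M 0 ω = m) {σ : Ω → WithTop ℝ≥0}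
    (hmart : Martingale (stoppedProcess
      (fun i => {ω | ⊥ < σ ω}.indicator fun ω => M i ω ^ 2 - A i ω) σ) 𝓕 P)
    {x : ℝ} (hx : m ≤ x) (t : ℝ≥0) :
    P {ω | ⊥ < σ ω ∧ x ^ 2 ≤ A (minTime (σ ω) t) ω ∧ denseSup M ω ≤ ENNReal.ofReal x}
      ≤ ENNReal.ofReal (2 * m / x) := by
  have hx0 : 0 < x := hm.trans_le hx
  set Z : ℝ≥0 → Ω → ℝ := stoppedProcess
    (fun i => {ω | ⊥ < σ ω}.indicator fun ω => M i ω ^ 2 - A i ω) σ with hZ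
  set T : Ω → ℝ≥0 := fun ω => ⨅ N, crossTime M x t N ω with hT
  set V : Ω → ℝ := fun ω => (min (denseSup M ω) (ENNReal.ofReal x)).toReal ^ 2 with hV
  obtain ⟨hVint, hVle⟩ := integral_min_toReal_sq_le (measurable_denseSup hM.adapted) hm.le hx0
    fun y hy => hM.measure_lt_denseSup_le hpos hm.le h0 hy
  have hZpos : ∀ {ω}, ⊥ < σ ω → ∀ s, Z s ω = M (minTime (σ ω) s) ω ^ 2 - A (minTime (σ ω) s) ω :=
    fun h s => stoppedProcess_indicator_of_pos (X := fun i ω => M i ω ^ 2 - A i ω) h s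
  have hZneg : ∀ {ω}, ¬ ⊥ < σ ω → ∀ s, Z s ω = 0 :=
    fun h s => stoppedProcess_indicator_of_not_pos (X := fun i ω => M i ω ^ 2 - A i ω) h s
  have hlim : ∀ᵐ ω ∂P, Tendsto (fun N => Z (crossTime M x t N ω) ω) atTop (𝓝 (Z (T ω) ω)) := by
    filter_upwards [hM.continuous_paths, hA.continuous_paths] with ω hcM hcA
    by_cases h : ⊥ < σ ω
    · have hc : Continuous fun s => Z s ω := by
        simp only [hZpos h]
        exact ((hcM.comp (continuous_minTime _)).pow 2).sub (hcA.comp (continuous_minTime _))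
      exact (hc.tendsto _).comp (tendsto_crossTime ω)
    · simp only [hZneg h]
      exact tendsto_const_nhds
  obtain ⟨hWint, hWeq⟩ := hmart.integral_of_tendsto_crossTime hM.adapted x t hlim
  have hZ0 : 0 ≤ ∫ ω, Z 0 ω ∂P := by
    refine integral_nonneg_of_ae ?_
    filter_upwards [hA.start_zero] with ω hω
    by_cases h : ⊥ < σ ω
    · simp only [hZpos h, minTime_zero, hω, sub_zero, Pi.zero_apply]
      positivity
    · simp [hZneg h]
  -- Where `σ > 0`, `D` is `A + (V - M ^ 2)` at the stopped time, and `M ^ 2 ≤ V` up to `T`; so `D`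
  -- dominates the stopped bracket while its mean is computed by optional sampling.
  set D : Ω → ℝ := fun ω => V ω - Z (T ω) ω with hD
  have hDle : ∫ ω, D ω ∂P ≤ 2 * x * m := by
    rw [hD, integral_sub hVint hWint, hWeq]
    linarith
  have hsqle : ∀ᵐ ω ∂P, ∀ s ≤ T ω, M s ω ^ 2 ≤ V ω := by
    filter_upwards [hM.continuous_paths, hpos, h0] with ω hc hω h0ω s hs
    refine pow_le_pow_left₀ (hω s) ?_ 2
    rw [← ENNReal.ofReal_le_iff_le_toReal (min_lt_of_right_lt ENNReal.ofReal_lt_top).ne]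
    exact le_min (le_denseSup hc s) (ENNReal.ofReal_le_ofReal
      (apply_le_of_le_iInf_crossTime hc (h0ω.trans_le hx) hs))
  have hDnonneg : 0 ≤ᵐ[P] D := by
    filter_upwards [hsqle, hA.ae_nonneg] with ω hsq hAω
    by_cases h : ⊥ < σ ω
    · have h1 := hsq _ (minTime_le (σ ω) (T ω))
      have h2 := hAω (minTime (σ ω) (T ω))
      simp only [hD, hZpos h, Pi.zero_apply]
      linarith
    · simp only [hD, hZneg h, Pi.zero_apply, hV, sub_zero]
      positivity
  have hsub : {ω | ⊥ < σ ω ∧ x ^ 2 ≤ A (minTime (σ ω) t) ω ∧ denseSup M ω ≤ ENNReal.ofReal x}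
      ≤ᵐ[P] {ω | x ^ 2 ≤ D ω} := by
    filter_upwards [hsqle] with ω hsq
    rintro ⟨h, hAx, hle⟩
    have hTt : T ω = t := by
      have : ∀ N, crossTime M x t N ω = t := crossTime_eq_of_forall_le fun i =>
        (ENNReal.ofReal_le_ofReal_iff hx0.le).1 ((le_iSup (fun i =>
          ENNReal.ofReal (M (TopologicalSpace.denseSeq ℝ≥0 i) ω)) i).trans hle)
      simp [hT, this]
    have h1 := hsq _ (minTime_le (σ ω) (T ω))
    change x ^ 2 ≤ D ω
    simp only [hD, hZpos h]
    rw [hTt] at h1 ⊢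
    linarith
  have hmk := mul_meas_ge_le_integral_of_nonneg hDnonneg (hVint.sub hWint) (x ^ 2)
  calc _ ≤ P {ω | x ^ 2 ≤ D ω} := measure_mono_ae hsub
    _ = ENNReal.ofReal (P.real {ω | x ^ 2 ≤ D ω}) := (ofReal_measureReal).symm
    _ ≤ _ := by
      refine ENNReal.ofReal_le_ofReal ?_
      rw [le_div_iff₀' hx0]
      have : x ^ 2 * P.real {ω | x ^ 2 ≤ D ω} ≤ 2 * x * m := hmk.trans hDle
      nlinarith

theorem IsBracket.measure_lt_terminalValue_le (hA : IsBracket A M 𝓕 P)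
    (hM : IsContinuousLocalMartingale M 𝓕 P) (hpos : ∀ᵐ ω ∂P, ∀ t, 0 ≤ M t ω)
    (hm : 0 < m) (h0 : ∀ᵐ ω ∂P, M 0 ω = m) {x : ℝ} (hx0 : 0 < x) :
    P {ω | ENNReal.ofReal (x ^ 2) < terminalValue A ω} ≤ ENNReal.ofReal (3 * m / x) := by
  -- For `x < m` the claimed bound exceeds `1`; otherwise `M` starts at or below the level `x`.
  rcases lt_or_ge x m with hxm | hmx
  · refine prob_le_one.trans ?_
    rw [ENNReal.one_le_ofReal, one_le_div hx0]
    linarith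
  obtain ⟨σ, hσ, hmart⟩ := hA.sq_sub.locally_martingale
  have hbound := measure_eventually_mem_le (P := P) (c := ENNReal.ofReal (2 * m / x))
    (s := fun k : ℕ => {ω | ⊥ < σ k ω ∧ x ^ 2 ≤ A (minTime (σ k ω) k) ω ∧
      denseSup M ω ≤ ENNReal.ofReal x}) fun k =>
        hA.measure_stopped_le hM hpos hm h0 (hmart k) hmx k
  have hsub : {ω | ENNReal.ofReal (x ^ 2) < terminalValue A ω}
      ≤ᵐ[P] ({ω | ENNReal.ofReal x < denseSup M ω} ∪ {ω | ∀ᶠ k : ℕ in atTop, ω ∈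
        {ω | ⊥ < σ k ω ∧ x ^ 2 ≤ A (minTime (σ k ω) k) ω ∧ denseSup M ω ≤ ENNReal.ofReal x}} :
          Set Ω) := by
    filter_upwards [hσ.tendsto_top, hA.monotone_paths] with ω hω hmono
      (hlt : ENNReal.ofReal (x ^ 2) < terminalValue A ω)
    rcases lt_or_ge (ENNReal.ofReal x) (denseSup M ω) with h | h
    · exact Or.inl h
    · right
      obtain ⟨s, hs⟩ := lt_iSup_iff.1 hlt
      have hs' := (ENNReal.ofReal_lt_ofReal_iff_of_nonneg (by positivity)).1 hs
      change ∀ᶠ k : ℕ in atTop, _ ∧ _ ∧ _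
      filter_upwards [eventually_coe_lt_of_tendsto hω s,
        tendsto_natCast_atTop_atTop.eventually_ge_atTop s] with k hk hsk
      exact ⟨bot_le.trans_lt hk, hs'.le.trans (hmono (le_minTime hsk hk.le)), h⟩
  calc _ ≤ _ := measure_mono_ae hsub
    _ ≤ _ := measure_union_le _ _
    _ ≤ ENNReal.ofReal (m / x) + ENNReal.ofReal (2 * m / x) :=
      add_le_add (hM.measure_lt_denseSup_le hpos hm.le h0 hx0) hbound
    _ = ENNReal.ofReal (3 * m / x) := by
      rw [← ENNReal.ofReal_add (by positivity) (by positivity)]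
      congr 1
      ring

end Maximal

/-! ### Moments from the two tail bounds -/

theorem mainTheorem7 (γ : ℝ) (hγ : γ ∈ Set.Ioo (0 : ℝ) 1) :
    ∃ C : ℝ, 0 < C ∧
      ∀ (Ω : Type*) (mΩ : MeasurableSpace Ω) (P : Measure Ω) (_ : IsProbabilityMeasure P)
        (𝓕 : Filtration ℝ≥0 mΩ) (M A : ℝ≥0 → Ω → ℝ) (m : ℝ),
        0 < m →
        IsContinuousLocalMartingale M 𝓕 P →
        (∀ᵐ ω ∂P, ∀ t, 0 ≤ M t ω) →
        (∀ᵐ ω ∂P, M 0 ω = m) →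
        IsBracket A M 𝓕 P →
        ∫⁻ ω, ((⨆ t : ℝ≥0, ENNReal.ofReal (M t ω ^ γ)) + terminalValue A ω ^ (γ / 2)) ∂P
          ≤ ENNReal.ofReal (C * m ^ γ) := by
  obtain ⟨hγ0, hγ1⟩ := hγ
  have hγ' : 0 < 1 - γ := by linarith
  -- The summands come from `K = m` for the supremum and `K = 3 * m` for the square root of the
  -- bracket.
  refine ⟨(1 + 3 ^ γ) / (1 - γ), by positivity, ?_⟩
  intro Ω mΩ P _ 𝓕 M A m hm hM hpos h0 hA
  have hU := measurable_denseSup hM.adapted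
  have hsup : ∫⁻ ω, denseSup M ω ^ γ ∂P ≤ ENNReal.ofReal (m ^ γ / (1 - γ)) :=
    lintegral_rpow_le_of_tail_le hU.aemeasurable hm hγ0 hγ1 fun x hx =>
      hM.measure_lt_denseSup_le hpos hm.le h0 hx
  have hbr : ∫⁻ ω, (terminalValue A ω ^ (1 / 2 : ℝ)) ^ γ ∂P
      ≤ ENNReal.ofReal ((3 * m) ^ γ / (1 - γ)) := by
    refine lintegral_rpow_le_of_tail_le (hA.aemeasurable_terminalValue.pow_const _) (by positivity)
      hγ0 hγ1 fun x hx => ?_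
    refine (measure_mono fun ω hω => ?_).trans (hA.measure_lt_terminalValue_le hM hpos hm h0 hx)
    have h : ENNReal.ofReal x < terminalValue A ω ^ (1 / 2 : ℝ) := hω
    have h2 := ENNReal.rpow_lt_rpow h two_pos
    rw [← ENNReal.rpow_mul, ENNReal.ofReal_rpow_of_pos hx] at h2
    simpa using h2
  calc _ ≤ ∫⁻ ω, (denseSup M ω ^ γ + (terminalValue A ω ^ (1 / 2 : ℝ)) ^ γ) ∂P := by
        refine lintegral_mono_ae ?_
        filter_upwards [hM.continuous_paths, hpos] with ω hc hω
        refine add_le_add (iSup_le fun t => ?_) (le_of_eq ?_)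
        · rw [← ENNReal.ofReal_rpow_of_nonneg (hω t) hγ0.le]
          exact ENNReal.rpow_le_rpow (le_denseSup hc t) hγ0.le
        · rw [← ENNReal.rpow_mul]
          congr 1
          ring
    _ = ∫⁻ ω, denseSup M ω ^ γ ∂P + ∫⁻ ω, (terminalValue A ω ^ (1 / 2 : ℝ)) ^ γ ∂P :=
        lintegral_add_left (hU.pow_const _) _
    _ ≤ ENNReal.ofReal (m ^ γ / (1 - γ)) + ENNReal.ofReal ((3 * m) ^ γ / (1 - γ)) :=
        add_le_add hsup hbr
    _ = _ := by
        rw [← ENNReal.ofReal_add (by positivity) (by positivity),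
          Real.mul_rpow (by norm_num) hm.le]
        congr 1
        ring
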